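/- **Setting.** Let $\alpha\ge 1$. For a real random variable $X$ put $$\|X\|_{\psi_\alpha}=\inf\{t>0:\ \mathbb E\,\psi_\alpha(|X|/t)\le 1\}\in[0,\infty],\qquad \psi_\alpha(s)=e^{s^\alpha}-1,$$ and put $\underline{\log}\,s=\max(\ln s,1)$ for real $s$. Let $(\mathcal Y,\|\cdot\|)$ be a normed space equipped with a $\sigma$-algebra, let $n\ge 1$, and assume that the function $$f:\mathcal Y^n\to\mathbb R,\qquad f(y)=\tfrac12\Big\|\sum_{i=1}^n y_i\Big\|,$$ is measurable with respect to the product $\sigma$-algebra (for separable $\mathcal Y$ with its Borel $\sigma$-algebra this is automatic). Let $Y_1,\dots,Y_n$ be independent, not necessarily identically distributed, random variables with values in $\mathcal Y$ such that $\big\|\|Y_i\|\big\|_{\psi_\alpha}<\infty$ for all $i$, and let $Y=(Y_1,\dots,Y_n)$. Let $K,U,\sigma\ge 0$ be given by $$K=\max_{i}\big\|\|Y_i\|\big\|_{\psi_\alpha},\qquad U^2=\sum_{i=1}^n\big\|\|Y_i\|\big\|_{\psi_\alpha}^2,\qquad \sigma^2=\sum_{i=1}^n\mathbb E\|Y_i\|^2,$$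 and let $$z=\Big(4\,\underline{\log}\,\frac{eU}{\sigma}\Big)^{1/\alpha}.$$ **Statement.** For every $x>0$, with probability at least $1-e^{-x}$, both of the following bounds hold simultaneously: $$f(Y)-\mathbb E f(Y)\ \le\ \sigma\sqrt{2x\,\frac{n+1}{n}}+\frac{4Kzx}{\min\Big\{2\alpha z^{\alpha},\ \underline{\log}\Big(\Big(\frac{Kz}{\sigma\frac{n+1}{n}}\Big)^{2}x\Big)\Big\}},$$ $$f(Y)-\mathbb E f(Y)\ \le\ \sigma\sqrt{2x\,\frac{n+1}{n}}+\frac34\,Kzx\,\frac{n+1}{n}.$$ (If $\sigma=0$, then all $Y_i$ vanish almost surely, $K=0$, and the right-hand sides are read as $0$.) -/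

import Mathlib

open MeasureTheory ProbabilityTheory
open scoped ENNReal

noncomputable section

/-- The Orlicz function `ψ_α(t) = exp(t ^ α) - 1`, used for `t ≥ 0`. -/
def orliczPsi (α t : ℝ) : ℝ := Real.exp (t ^ α) - 1

/-- The `ψ_α`-Orlicz norm `inf {t > 0 : E ψ_α(|X| / t) ≤ 1}` of a real random variable,
with values in `[0, ∞]`; it is `∞` when no such `t` exists. -/
def orliczENorm {Ω : Type*} [MeasurableSpace Ω] (μ : Measure Ω) (α : ℝ) (X : Ω → ℝ) : ℝ≥0∞ :=
  ⨅ (t : ℝ) (_ : 0 < t) (_ : ∫⁻ ω, ENNReal.ofReal (orliczPsi α (|X ω| / t)) ∂μ ≤ 1),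
    ENNReal.ofReal t

/-- The `ψ_α`-Orlicz norm as a real number, for random variables for which it is finite. -/
def orliczNorm {Ω : Type*} [MeasurableSpace Ω] (μ : Measure Ω) (α : ℝ) (X : Ω → ℝ) : ℝ :=
  (orliczENorm μ α X).toReal

/-- The truncated logarithm `max (ln x) 1`. -/
def truncLog (x : ℝ) : ℝ := max (Real.log x) 1

/-- The function `f(y) = ‖y_1 + ⋯ + y_n‖ / 2`. -/
def halfNormSum {E : Type*} [NormedAddCommGroup E] {n : ℕ} (y : Fin n → E) : ℝ :=
  1 / 2 * ‖∑ i, y i‖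

/-- The right-hand side of the Bennett-type bound. -/
def bennettBound (n : ℕ) (α σ K z x : ℝ) : ℝ :=
  σ * √(2 * x * (((n : ℝ) + 1) / n)) +
    4 * K * z * x /
      min (2 * α * z ^ α) (truncLog ((K * z / (σ * (((n : ℝ) + 1) / n))) ^ 2 * x))

/-- The right-hand side of the Bernstein-type bound. -/
def bernsteinBound (n : ℕ) (σ K z x : ℝ) : ℝ :=
  σ * √(2 * x * (((n : ℝ) + 1) / n)) + 3 / 4 * K * z * x * (((n : ℝ) + 1) / n)

end

/-!
The deviation `f(Y) - E f(Y)` is controlled by Chernoff's method. Write `W i = ‖Y i‖`,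
`k i = ‖W i‖_{ψ_α}`, `B = K * z`, and let `u = c * B` be the normalised Chernoff parameter.

*Moment generating function.* The function `f` is `1/2`-Lipschitz in each variable. Integrating out
one variable at a time and comparing each increment with `(‖y‖ + ‖y'‖) / 2` for an independent copy
`y'`, convexity of `s ↦ e ^ s - 1 - s` gives
`log E e ^ (c * (f(Y) - E f(Y))) ≤ ∑ i, E (e ^ (c * W i) - 1 - c * W i)`
(`lintegral_exp_lipschitz_pi_le`).

*The single variables.* The quadratic part of the right-hand side is exactly `c ^ 2 * σ ^ 2 / 2`.
For the remainder `expRem3`, values `W i ≤ B` contribute at most `expRem3 u / B ^ 2 * E (W i) ^ 2`.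
As long as `u ≤ α * z ^ α / 2`, the exponent `c * W i` grows beyond the level `B` at most as fast
as `(W i / k i) ^ α / 2`, by the tangent line inequality at `z`. Half of the Orlicz exponential is
thus still available, and by the choice of `z` it produces the small factor
`e ^ (-z ^ α / 2) ≤ (σ / (e * U)) ^ 2`. Summation over `i` turns this into a second copy of
`expRem3 u / B ^ 2 * σ ^ 2` (`expRem3_pointwise`, `integral_expRem2_le`). Altogether,
`log E e ^ (c * (f(Y) - E f(Y))) ≤ σ ^ 2 / B ^ 2 * (u ^ 2 / 2 + 2 * expRem3 u)`.

*Choice of the parameter.* Already without the factors `(n + 1) / n`, which only enlarge the two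
bounds, the Bernstein-type bound follows by optimising
`u ^ 2 / 2 + 2 * expRem3 u ≤ u ^ 2 / (2 * (1 - 3 / 4 * u))`
(`exists_bernstein_exponent`), and the Bennett-type bound by taking `u` to be a quarter of the
minimum in its denominator (`bennett_exponent`), unless the truncated logarithm equals `1`, in
which case the Bernstein-type estimate is the stronger one. Both bounds being deterministic, they
hold simultaneously as soon as the smaller one does.
-/

/-! ### Remainders of the exponential series -/

/-- The remainder `e ^ u - 1 - u` of the exponential series after the linear term. -/
noncomputable def expRem2 (u : ℝ) : ℝ := Real.exp u - 1 - u

/-- The remainder `e ^ u - 1 - u - u ^ 2 / 2` of the exponential series after the quadratic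
term. -/
noncomputable def expRem3 (u : ℝ) : ℝ := Real.exp u - 1 - u - u ^ 2 / 2

lemma expRem2_eq (u : ℝ) : expRem2 u = u ^ 2 / 2 + expRem3 u := by
  simp only [expRem2, expRem3]; ring

/-- Inequalities between the remainders are proved by integrating the inequality between the
derivatives from `0`. -/
lemma nonneg_of_hasDerivAt_nonneg {f f' : ℝ → ℝ} (hf : ∀ x, HasDerivAt f (f' x) x)
    (h0 : f 0 = 0) (h : ∀ x, 0 ≤ x → 0 ≤ f' x) {x : ℝ} (hx : 0 ≤ x) : 0 ≤ f x := by
  have hm : MonotoneOn f (Set.Ici 0) := by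
    refine monotoneOn_of_deriv_nonneg (convex_Ici 0)
      (fun y _ => (hf y).continuousAt.continuousWithinAt)
      (fun y _ => (hf y).differentiableAt.differentiableWithinAt) fun y hy => ?_
    rw [interior_Ici] at hy
    rw [(hf y).deriv]
    exact h y (le_of_lt hy)
  simpa [h0] using hm (Set.mem_Ici.2 le_rfl) (Set.mem_Ici.2 hx) hx

lemma hasDerivAt_expRem2 (u : ℝ) : HasDerivAt expRem2 (Real.exp u - 1) u :=
  ((Real.hasDerivAt_exp u).sub_const 1).sub (hasDerivAt_id u)

lemma hasDerivAt_expRem3 (u : ℝ) : HasDerivAt expRem3 (expRem2 u) u := by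
  have h := (hasDerivAt_expRem2 u).sub (((hasDerivAt_id u).pow 2).div_const 2)
  refine (h.congr_deriv ?_).congr_of_eventuallyEq (.of_forall fun y => ?_)
  · simp [expRem2]
  · simp [expRem2, expRem3]

lemma expRem2_nonneg (u : ℝ) : 0 ≤ expRem2 u := by
  have := Real.add_one_le_exp u
  simp only [expRem2]; linarith

lemma expRem3_nonneg {u : ℝ} (hu : 0 ≤ u) : 0 ≤ expRem3 u := by
  have := Real.quadratic_le_exp_of_nonneg hu
  simp only [expRem3]; linarith

lemma expRem2_mul_le {s u : ℝ} (hs0 : 0 ≤ s) (hs1 : s ≤ 1) (hu : 0 ≤ u) :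
    expRem2 (s * u) ≤ s * expRem2 u := by
  have := nonneg_of_hasDerivAt_nonneg (f := fun u => s * expRem2 u - expRem2 (s * u))
    (f' := fun u => s * (Real.exp u - 1) - (Real.exp (s * u) - 1) * s)
    (fun y => ((hasDerivAt_expRem2 y).const_mul s).sub
      ((hasDerivAt_expRem2 (s * y)).comp y (by simpa using (hasDerivAt_id y).const_mul s)))
    (by simp [expRem2])
    (fun y hy => by
      have : Real.exp (s * y) ≤ Real.exp y := Real.exp_le_exp.2 (by nlinarith)
      nlinarith) hu
  simpa using this

lemma expRem3_mul_le {s u : ℝ} (hs0 : 0 ≤ s) (hs1 : s ≤ 1) (hu : 0 ≤ u) :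
    expRem3 (s * u) ≤ s ^ 2 * expRem3 u := by
  have := nonneg_of_hasDerivAt_nonneg (f := fun u => s ^ 2 * expRem3 u - expRem3 (s * u))
    (f' := fun u => s ^ 2 * expRem2 u - expRem2 (s * u) * s)
    (fun y => ((hasDerivAt_expRem3 y).const_mul (s ^ 2)).sub
      ((hasDerivAt_expRem3 (s * y)).comp y (by simpa using (hasDerivAt_id y).const_mul s)))
    (by simp [expRem3])
    (fun y hy => by nlinarith [expRem2_mul_le hs0 hs1 hy]) hu
  simpa using this

/-- The derivative of `e ^ (-u) * expRem3 u` has the simple form `u ^ 2 * e ^ (-u) / 2`. -/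
lemma hasDerivAt_exp_neg_mul_expRem3 (u : ℝ) :
    HasDerivAt (fun u => Real.exp (-u) * expRem3 u) (u ^ 2 / 2 * Real.exp (-u)) u := by
  have h := ((hasDerivAt_neg u).exp).mul (hasDerivAt_expRem3 u)
  refine h.congr_deriv ?_
  rw [expRem2_eq]; ring

lemma expRem3_le {u : ℝ} (hu : 0 ≤ u) : expRem3 u ≤ u ^ 3 / 6 * Real.exp u := by
  have := nonneg_of_hasDerivAt_nonneg
    (f := fun u => u ^ 3 / 6 - Real.exp (-u) * expRem3 u)
    (f' := fun u => 3 * u ^ 2 / 6 - u ^ 2 / 2 * Real.exp (-u))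
    (fun y => (by simpa using ((hasDerivAt_id y).pow 3).div_const 6 :
      HasDerivAt (fun u : ℝ => u ^ 3 / 6) (3 * y ^ 2 / 6) y).sub
        (hasDerivAt_exp_neg_mul_expRem3 y))
    (by simp [expRem3])
    (fun y hy => by
      have : Real.exp (-y) ≤ 1 := Real.exp_le_one_iff.2 (by linarith)
      nlinarith [sq_nonneg y]) hu
  have h2 : Real.exp (-u) * Real.exp u = 1 := by rw [← Real.exp_add]; simp
  have := mul_nonneg this (Real.exp_pos u).le
  have h3 : Real.exp (-u) * expRem3 u * Real.exp u = expRem3 u := by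
    rw [mul_right_comm, h2, one_mul]
  linarith [sub_mul (u ^ 3 / 6) (Real.exp (-u) * expRem3 u) (Real.exp u)]

/-- Growth of `expRem3` beyond a threshold `u`: the function `e ^ (-u) * expRem3 u / u ^ 3` is
antitone. -/
lemma expRem3_mul_le_of_one_le {s u : ℝ} (hs : 1 ≤ s) (hu : 0 ≤ u) :
    expRem3 (s * u) ≤ s ^ 3 * Real.exp (s * u - u) * expRem3 u := by
  have := nonneg_of_hasDerivAt_nonneg
    (f := fun u => s ^ 3 * (Real.exp (-u) * expRem3 u) - Real.exp (-(s * u)) * expRem3 (s * u))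
    (f' := fun u => s ^ 3 * (u ^ 2 / 2 * Real.exp (-u)) -
      (s * u) ^ 2 / 2 * Real.exp (-(s * u)) * s)
    (fun y => ((hasDerivAt_exp_neg_mul_expRem3 y).const_mul (s ^ 3)).sub
      ((hasDerivAt_exp_neg_mul_expRem3 (s * y)).comp y
        (by simpa using (hasDerivAt_id y).const_mul s)))
    (by simp [expRem3])
    (fun y hy => by
      have h : Real.exp (-(s * y)) ≤ Real.exp (-y) := Real.exp_le_exp.2 (by nlinarith)
      have h2 : 0 ≤ s ^ 3 * y ^ 2 / 2 := by positivity
      nlinarith [mul_le_mul_of_nonneg_left h h2]) hu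
  have h := mul_nonneg this (Real.exp_pos (s * u)).le
  have e1 : Real.exp (-(s * u)) * Real.exp (s * u) = 1 := by rw [← Real.exp_add]; simp
  have e2 : Real.exp (s * u - u) = Real.exp (-u) * Real.exp (s * u) := by
    rw [← Real.exp_add]; congr 1; ring
  rw [e2]
  have e3 : Real.exp (-(s * u)) * expRem3 (s * u) * Real.exp (s * u) = expRem3 (s * u) := by
    rw [mul_right_comm, e1, one_mul]
  nlinarith

lemma expRem2_le_abs (u : ℝ) : expRem2 u ≤ expRem2 |u| := by
  rcases le_total 0 u with h | h
  · rw [abs_of_nonneg h]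
  · rw [abs_of_nonpos h]
    have := Real.self_le_sinh_iff.2 (neg_nonneg.2 h)
    rw [Real.sinh_eq, neg_neg] at this
    simp only [expRem2]; linarith

lemma expRem2_mono {u v : ℝ} (hu : 0 ≤ u) (h : u ≤ v) : expRem2 u ≤ expRem2 v := by
  have h1 := Real.add_one_le_exp (v - u)
  have h2 : Real.exp v = Real.exp u * Real.exp (v - u) := by rw [← Real.exp_add]; ring_nf
  have h3 : 1 ≤ Real.exp u := Real.one_le_exp hu
  have h4 := mul_le_mul_of_nonneg_left h1 (Real.exp_pos u).le
  have h5 := mul_le_mul_of_nonneg_right h3 (sub_nonneg.2 h)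
  simp only [expRem2]; nlinarith

lemma convexOn_expRem2 : ConvexOn ℝ Set.univ expRem2 := by
  have h := (convexOn_exp.add_const (-1)).sub (concaveOn_id (𝕜 := ℝ) convex_univ)
  refine h.congr fun x _ => ?_
  simp [expRem2, sub_eq_add_neg]

/-! ### Choice of the Chernoff parameter -/

/-- The Chernoff exponent for the Bernstein-type bound. -/
lemma exists_bernstein_exponent {σ B x : ℝ} (hσ : 0 < σ) (hB : 0 < B) (hx : 0 < x) :
    ∃ u, 0 < u ∧ u ≤ 2 ∧ x + σ ^ 2 / B ^ 2 * (u ^ 2 / 2 + 2 * expRem3 u) ≤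
      u / B * (σ * √(2 * x) + 3 / 4 * B * x) := by
  set q := √(2 * x) with hq
  have hq0 : 0 < q := Real.sqrt_pos.2 (by positivity)
  have hq2 : q ^ 2 = 2 * x := Real.sq_sqrt (by positivity)
  set w := B * q / σ with hw
  have hw0 : 0 < w := by positivity
  -- the maximiser of `u ↦ u * t - u ^ 2 / (2 * (1 - 3 / 4 * u))` in normalised variables
  set u := w / (1 + 3 / 4 * w) with hu
  have hu0 : 0 < u := by positivity
  have hd : 1 - 3 / 4 * u = 1 / (1 + 3 / 4 * w) := by rw [hu]; field_simp; ring
  have hd0 : 0 < 1 - 3 / 4 * u := by rw [hd]; positivity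
  refine ⟨u, hu0, by linarith, ?_⟩
  -- the left-hand side is maximal at `u = 1 / 3`, where it equals `3 / 4 * e ^ (1 / 3)`
  have hexp : Real.exp u * (1 - 3 / 4 * u) ≤ 9 / 8 := by
    have h1 := Real.add_one_le_exp (1 / 3 - u)
    have h2 : Real.exp u * Real.exp (1 / 3 - u) = Real.exp (1 / 3) := by
      rw [← Real.exp_add]; ring_nf
    have h3 : Real.exp (1 / 3) ≤ 3 / 2 := by
      have h4 : Real.exp (1 / 3) ^ 3 = Real.exp 1 := by
        rw [← Real.exp_nat_mul]; norm_num
      have h5 := Real.exp_one_lt_d9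
      by_contra! h6
      have : (3 / 2 : ℝ) ^ 3 < Real.exp (1 / 3) ^ 3 :=
        pow_lt_pow_left₀ h6 (by norm_num) (by norm_num)
      rw [h4] at this
      norm_num at this h5; linarith
    have h4 := mul_le_mul_of_nonneg_left h1 (Real.exp_pos u).le
    nlinarith
  have hmain : u ^ 2 / 2 + 2 * expRem3 u ≤ u ^ 2 / 2 * (1 + 3 / 4 * w) := by
    have h1 := expRem3_le hu0.le
    have h2 : Real.exp u ≤ 9 / 8 * (1 + 3 / 4 * w) := by
      rw [hd, mul_one_div, div_le_iff₀ (by positivity)] at hexp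
      exact hexp
    have h3 : u * (1 + 3 / 4 * w) = w := by rw [hu]; field_simp
    have h4 : u ^ 3 / 6 * Real.exp u ≤ u ^ 3 / 6 * (9 / 8 * (1 + 3 / 4 * w)) := by gcongr
    have h5 : u ^ 3 / 6 * (9 / 8 * (1 + 3 / 4 * w)) = 3 / 16 * u ^ 2 * w := by
      linear_combination 3 / 16 * u ^ 2 * h3
    nlinarith
  have hx' : x = q ^ 2 / 2 := by linarith
  have key : u / B * (σ * q + 3 / 4 * B * x) =
      x + σ ^ 2 / B ^ 2 * (u ^ 2 / 2 * (1 + 3 / 4 * w)) := by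
    rw [hx', hu, hw]; field_simp; ring
  rw [key]
  gcongr

/-- The Chernoff exponent for the Bennett-type bound, with `u = M / 4`. -/
lemma bennett_exponent {σ B x M : ℝ} (hσ : 0 < σ) (hB : 0 < B) (hx : 0 < x) (hM : 0 < M)
    (hML : M ≤ Real.log ((B / σ) ^ 2 * x)) :
    x + σ ^ 2 / B ^ 2 * ((M / 4) ^ 2 / 2 + 2 * expRem3 (M / 4)) ≤
      M / 4 / B * (σ * √(2 * x) + 4 * B * x / M) := by
  set u := M / 4 with hu
  have hu0 : 0 < u := by positivity
  have h1 : Real.exp (2 * u) ^ 2 ≤ (B / σ) ^ 2 * x := by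
    rw [← Real.exp_nat_mul]
    calc _ ≤ Real.exp (Real.log ((B / σ) ^ 2 * x)) := Real.exp_le_exp.2 (by push_cast; linarith)
      _ = _ := Real.exp_log (by positivity)
  have h2 : Real.exp (2 * u) ≤ B / σ * √(2 * x) := by
    apply le_of_sq_le_sq _ (by positivity)
    rw [mul_pow, Real.sq_sqrt (by positivity)]
    have : 0 ≤ (B / σ) ^ 2 * x := by positivity
    linarith
  have h3 : u ^ 2 / 2 + 2 * expRem3 u ≤ u * Real.exp (2 * u) := by
    have a := expRem3_le hu0.le
    have b := Real.quadratic_le_exp_of_nonneg hu0.le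
    have c : Real.exp (2 * u) = Real.exp u * Real.exp u := by rw [← Real.exp_add]; ring_nf
    have d : 1 ≤ Real.exp u := Real.one_le_exp hu0.le
    rw [c]
    have e : u / 2 + u ^ 2 / 3 * Real.exp u ≤ Real.exp u * Real.exp u := by nlinarith
    nlinarith [mul_le_mul_of_nonneg_left e hu0.le]
  have h4 : σ ^ 2 / B ^ 2 * (u ^ 2 / 2 + 2 * expRem3 u) ≤
      σ ^ 2 / B ^ 2 * (u * (B / σ * √(2 * x))) := by
    have := h3.trans (mul_le_mul_of_nonneg_left h2 hu0.le)
    gcongr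
  have h5 : u / B * (σ * √(2 * x) + 4 * B * x / M) =
      x + σ ^ 2 / B ^ 2 * (u * (B / σ * √(2 * x))) := by
    rw [hu]; field_simp; ring
  linarith

/-! ### The moment generating function of a Lipschitz function -/

section
variable {E : Type*} [NormedAddCommGroup E] [MeasurableSpace E]

lemma integrable_norm_of_exp {ν : Measure E} (hE : Measurable (fun y : E => ‖y‖)) {c : ℝ}
    (hc : 0 < c) (hint : Integrable (fun y => Real.exp (c * ‖y‖)) ν) :
    Integrable (fun y => ‖y‖) ν := by
  refine (hint.const_mul (1 / c)).mono' hE.aestronglyMeasurable (.of_forall fun y => ?_)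
  have := Real.add_one_le_exp (c * ‖y‖)
  rw [norm_norm, one_div, inv_mul_eq_div, le_div_iff₀ hc]
  linarith

lemma integrable_expRem2_norm {ν : Measure E} [IsProbabilityMeasure ν]
    (hE : Measurable (fun y : E => ‖y‖)) {c : ℝ}
    (hc : 0 < c) (hint : Integrable (fun y => Real.exp (c * ‖y‖)) ν) :
    Integrable (fun y => expRem2 (c * ‖y‖)) ν :=
  (hint.sub (integrable_const 1)).sub ((integrable_norm_of_exp hE hc hint).const_mul c)

/-- The moment generating function of a `1/2`-Lipschitz function of one variable: the increment
is compared with the average of two independent copies of the norm. -/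
lemma lintegral_exp_lipschitz_le {ν : Measure E} [IsProbabilityMeasure ν]
    (hE : Measurable (fun y : E => ‖y‖)) {c : ℝ} (hc : 0 < c)
    (hint : Integrable (fun y => Real.exp (c * ‖y‖)) ν) {g : E → ℝ} (hg : Measurable g)
    (hl : ∀ a b, |g a - g b| ≤ 1 / 2 * ‖a - b‖) :
    ∫⁻ y, ENNReal.ofReal (Real.exp (c * (g y - ∫ y', g y' ∂ν))) ∂ν ≤
      ENNReal.ofReal (Real.exp (∫ y, expRem2 (c * ‖y‖) ∂ν)) := by
  have hN := integrable_norm_of_exp hE hc hint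
  have hR := integrable_expRem2_norm hE hc hint
  set m := ∫ y, ‖y‖ ∂ν with hm
  have hm0 : 0 ≤ m := integral_nonneg fun y => norm_nonneg y
  have hgi : Integrable g ν := by
    refine ((integrable_const |g 0|).add (hN.const_mul (1 / 2))).mono' hg.aestronglyMeasurable
      (.of_forall fun y => ?_)
    have h1 := hl y 0
    rw [sub_zero] at h1
    have h2 := abs_sub_abs_le_abs_sub (g y) (g 0)
    simp only [Real.norm_eq_abs, Pi.add_apply]
    linarith
  set D : E → ℝ := fun y => c * (g y - ∫ y', g y' ∂ν) with hD
  have hDi : Integrable D ν := (hgi.sub (integrable_const _)).const_mul c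
  have hDm : Measurable D := (hg.sub_const _).const_mul c
  have hD0 : ∫ y, D y ∂ν = 0 := by
    simp only [hD]
    rw [integral_const_mul, integral_sub hgi (integrable_const _)]
    simp
  have hDabs : ∀ y, |D y| ≤ c * (1 / 2 * ‖y‖ + 1 / 2 * m) := by
    intro y
    simp only [hD]
    rw [abs_mul, abs_of_pos hc]
    gcongr
    have h1 : g y - ∫ y', g y' ∂ν = ∫ y', (g y - g y') ∂ν := by
      rw [integral_sub (integrable_const _) hgi]; simp
    rw [h1]
    have h2 : Integrable (fun y' : E => 1 / 2 * ‖y‖ + 1 / 2 * ‖y'‖) ν :=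
      (integrable_const _).add (hN.const_mul _)
    calc |∫ y', (g y - g y') ∂ν| ≤ ∫ y', |g y - g y'| ∂ν := abs_integral_le_integral_abs
      _ ≤ ∫ y', (1 / 2 * ‖y‖ + 1 / 2 * ‖y'‖) ∂ν := by
          refine integral_mono ((integrable_const _).sub hgi).abs h2 fun y' => ?_
          have := norm_sub_le y y'
          have := hl y y'
          simp only
          linarith
      _ = _ := by
          rw [integral_add (integrable_const _) (hN.const_mul _)]
          simp [hm, integral_const_mul]
  -- Jensen's inequality for the copy that was averaged out
  have hJ : expRem2 (c * m) ≤ ∫ y, expRem2 (c * ‖y‖) ∂ν := by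
    have := convexOn_expRem2.map_integral_le (μ := ν) (f := fun y : E => c * ‖y‖)
      (by unfold expRem2; fun_prop) isClosed_univ (by simp) (hN.const_mul c) hR
    rwa [integral_const_mul] at this
  have hpt : ∀ y, expRem2 (D y) ≤ 1 / 2 * expRem2 (c * ‖y‖) + 1 / 2 * expRem2 (c * m) := by
    intro y
    have h1 := expRem2_mono (abs_nonneg _) (hDabs y)
    have h2 := convexOn_expRem2.2 (Set.mem_univ (c * ‖y‖)) (Set.mem_univ (c * m))
      (by norm_num : (0 : ℝ) ≤ 1 / 2) (by norm_num : (0 : ℝ) ≤ 1 / 2) (by norm_num)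
    simp only [smul_eq_mul] at h2
    have h3 : 1 / 2 * (c * ‖y‖) + 1 / 2 * (c * m) = c * (1 / 2 * ‖y‖ + 1 / 2 * m) := by ring
    rw [h3] at h2
    exact (expRem2_le_abs _).trans (h1.trans h2)
  have hbi : Integrable (fun y => 1 / 2 * expRem2 (c * ‖y‖) + 1 / 2 * expRem2 (c * m)) ν :=
    (hR.const_mul _).add (integrable_const _)
  have hDRi : Integrable (fun y => expRem2 (D y)) ν := by
    refine hbi.mono' (by unfold expRem2; fun_prop) (.of_forall fun y => ?_)
    rw [Real.norm_of_nonneg (expRem2_nonneg _)]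
    exact hpt y
  have hDR : ∫ y, expRem2 (D y) ∂ν ≤ ∫ y, expRem2 (c * ‖y‖) ∂ν := by
    refine (integral_mono hDRi hbi hpt).trans ?_
    rw [integral_add (hR.const_mul _) (integrable_const _), integral_const_mul]
    simp only [integral_const, probReal_univ, one_smul]
    linarith
  have hexp : ∀ y, Real.exp (D y) = expRem2 (D y) + (1 + D y) := fun y => by
    simp only [expRem2]; ring
  have h1D : Integrable (fun y => 1 + D y) ν := (integrable_const 1).add hDi
  have hei : Integrable (fun y => Real.exp (D y)) ν := by
    simp_rw [hexp]; exact hDRi.add h1D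
  rw [← ofReal_integral_eq_lintegral_ofReal hei (.of_forall fun y => (Real.exp_pos _).le)]
  apply ENNReal.ofReal_le_ofReal
  simp_rw [hexp]
  rw [integral_add hDRi h1D, integral_add (integrable_const 1) hDi, hD0]
  simp only [integral_const, probReal_univ, one_smul, add_zero]
  have := Real.add_one_le_exp (∫ y, expRem2 (c * ‖y‖) ∂ν)
  linarith

lemma integrable_of_lipschitz_pi {n : ℕ} {ν : Fin n → Measure E} [∀ i, IsProbabilityMeasure (ν i)]
    (hN : ∀ i, Integrable (fun y => ‖y‖) (ν i)) {g : (Fin n → E) → ℝ} (hg : Measurable g)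
    (hl : ∀ a b, |g a - g b| ≤ 1 / 2 * ∑ i, ‖a i - b i‖) :
    Integrable g (Measure.pi ν) := by
  have hs : Integrable (fun y : Fin n → E => ∑ i, ‖y i‖) (Measure.pi ν) :=
    integrable_finsetSum _ fun i _ => integrable_comp_eval (hN i)
  refine ((integrable_const |g 0|).add (hs.const_mul (1 / 2))).mono' hg.aestronglyMeasurable
    (.of_forall fun y => ?_)
  have h1 := hl y 0
  simp only [Pi.zero_apply, sub_zero] at h1
  have h2 := abs_sub_abs_le_abs_sub (g y) (g 0)
  simp only [Real.norm_eq_abs, Pi.add_apply]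
  linarith

/-- Tensorisation of the moment generating function: integrating out the variables one at a time
multiplies the one-variable bounds. -/
theorem lintegral_exp_lipschitz_pi_le (hE : Measurable (fun y : E => ‖y‖)) {c : ℝ} (hc : 0 < c)
    {n : ℕ} (ν : Fin n → Measure E) [∀ i, IsProbabilityMeasure (ν i)]
    (hint : ∀ i, Integrable (fun y => Real.exp (c * ‖y‖)) (ν i))
    {g : (Fin n → E) → ℝ} (hg : Measurable g)
    (hl : ∀ a b, |g a - g b| ≤ 1 / 2 * ∑ i, ‖a i - b i‖) :
    ∫⁻ y, ENNReal.ofReal (Real.exp (c * (g y - ∫ y', g y' ∂Measure.pi ν))) ∂Measure.pi ν ≤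
      ENNReal.ofReal (Real.exp (∑ i, ∫ y, expRem2 (c * ‖y‖) ∂ν i)) := by
  induction n with
  | zero =>
    have h : ∀ y, g y = g 0 := fun y => congrArg g (Subsingleton.elim _ _)
    simp [h]
  | succ n ih =>
    have hN := fun i => integrable_norm_of_exp hE hc (hint i)
    have hmp := (measurePreserving_piFinSuccAbove ν 0).symm
    set e := (MeasurableEquiv.piFinSuccAbove (fun _ : Fin (n + 1) => E) 0).symm with he
    set ν' : Fin n → Measure E := fun j => ν (Fin.succAbove 0 j) with hν'
    set P := Measure.pi ν' with hP
    set h : E × (Fin n → E) → ℝ := fun p => g (e p) with hh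
    have hhm : Measurable h := hg.comp e.measurable
    have hlip : ∀ p q : E × (Fin n → E),
        |h p - h q| ≤ 1 / 2 * (‖p.1 - q.1‖ + ∑ i, ‖p.2 i - q.2 i‖) := by
      intro p q
      have := hl (e p) (e q)
      rw [Fin.sum_univ_succ] at this
      simpa [hh, he, MeasurableEquiv.piFinSuccAbove] using this
    have hgi : Integrable g (Measure.pi ν) := integrable_of_lipschitz_pi hN hg hl
    have hhi : Integrable h ((ν 0).prod P) :=
      (hmp.integrable_comp_emb e.measurableEmbedding).2 hgi
    have hsec : ∀ a, Measurable fun y => h (a, y) := fun a => hhm.comp measurable_prodMk_left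
    have hsl : ∀ a, ∀ y y', |h (a, y) - h (a, y')| ≤ 1 / 2 * ∑ i, ‖y i - y' i‖ := by
      intro a y y'
      simpa using hlip (a, y) (a, y')
    have hsi : ∀ a, Integrable (fun y => h (a, y)) P := fun a =>
      integrable_of_lipschitz_pi (fun i => hN _) (hsec a) (hsl a)
    set G : E → ℝ := fun a => ∫ y, h (a, y) ∂P with hG
    have hGm : Measurable G := (hhm.stronglyMeasurable.integral_prod_right).measurable
    have hGl : ∀ a b, |G a - G b| ≤ 1 / 2 * ‖a - b‖ := by
      intro a b
      simp only [hG]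
      rw [← integral_sub (hsi a) (hsi b)]
      refine abs_integral_le_integral_abs.trans ?_
      calc _ ≤ ∫ y, (1 / 2 * ‖a - b‖) ∂P :=
            integral_mono ((hsi a).sub (hsi b)).abs (integrable_const _) fun y => by
              simpa using hlip (a, y) (b, y)
        _ = _ := by simp
    have hEg : ∫ y', g y' ∂Measure.pi ν = ∫ a, G a ∂ν 0 := by
      rw [← hmp.integral_comp e.measurableEmbedding g]
      exact integral_prod h hhi
    rw [hEg, ← hmp.lintegral_comp_emb e.measurableEmbedding, lintegral_prod]
    swap
    · exact (((hhm.sub_const _).const_mul c).exp.ennreal_ofReal).aemeasurable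
    rw [Fin.sum_univ_succ, Real.exp_add, ENNReal.ofReal_mul (Real.exp_pos _).le]
    have hstep : ∀ a, ∫⁻ y, ENNReal.ofReal (Real.exp (c * (h (a, y) - ∫ a, G a ∂ν 0))) ∂P ≤
        ENNReal.ofReal (Real.exp (c * (G a - ∫ a, G a ∂ν 0))) *
          ENNReal.ofReal (Real.exp (∑ i : Fin n, ∫ y, expRem2 (c * ‖y‖) ∂ν i.succ)) := by
      intro a
      have h1 : ∀ y, ENNReal.ofReal (Real.exp (c * (h (a, y) - ∫ a, G a ∂ν 0))) =
          ENNReal.ofReal (Real.exp (c * (G a - ∫ a, G a ∂ν 0))) *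
            ENNReal.ofReal (Real.exp (c * (h (a, y) - ∫ y, h (a, y) ∂P))) := by
        intro y
        rw [← ENNReal.ofReal_mul (Real.exp_pos _).le, ← Real.exp_add]
        congr 2
        simp only [hG]; ring
      simp_rw [h1]
      rw [lintegral_const_mul _ (((hsec a).sub_const _).const_mul c).exp.ennreal_ofReal]
      gcongr
      exact ih ν' (fun i => hint _) (hsec a) (hsl a)
    refine (lintegral_mono hstep).trans ?_
    rw [lintegral_mul_const _ ((hGm.sub_const _).const_mul c).exp.ennreal_ofReal]
    gcongr
    exact lintegral_exp_lipschitz_le hE hc (hint 0) hGm hGl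

end

/-! ### Orlicz norms -/

lemma orliczNorm_nonneg {Ω : Type*} [MeasurableSpace Ω] (μ : Measure Ω) (α : ℝ) (X : Ω → ℝ) :
    0 ≤ orliczNorm μ α X := ENNReal.toReal_nonneg

section
variable {Ω : Type*} [MeasurableSpace Ω] {μ : Measure Ω} [IsProbabilityMeasure μ]

lemma self_le_exp_rpow {α w : ℝ} (hα : 1 ≤ α) (hw : 0 ≤ w) : w ≤ Real.exp (w ^ α) := by
  rcases le_total w 1 with h | h
  · exact h.trans (Real.one_le_exp (Real.rpow_nonneg hw α))
  · have h1 := Real.self_le_rpow_of_one_le h hα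
    have h2 := Real.add_one_le_exp (w ^ α)
    linarith

lemma lintegral_exp_rpow_le_two_of_orliczNorm_lt {α t : ℝ} (hα : 1 ≤ α) {X : Ω → ℝ}
    (hfin : orliczENorm μ α X ≠ ∞) (ht : orliczNorm μ α X < t) :
    ∫⁻ ω, ENNReal.ofReal (Real.exp ((|X ω| / t) ^ α)) ∂μ ≤ 2 := by
  have h1 : orliczENorm μ α X < ENNReal.ofReal t := (ENNReal.lt_ofReal_iff_toReal_lt hfin).2 ht
  simp only [orliczENorm, iInf_lt_iff] at h1
  obtain ⟨s, hs, hs1, hst⟩ := h1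
  have hst : s < t := (ENNReal.ofReal_lt_ofReal_iff_of_nonneg hs.le).1 hst
  calc ∫⁻ ω, ENNReal.ofReal (Real.exp ((|X ω| / t) ^ α)) ∂μ
      ≤ ∫⁻ ω, (ENNReal.ofReal (orliczPsi α (|X ω| / s)) + 1) ∂μ := by
        refine lintegral_mono fun ω => ?_
        have h2 : (|X ω| / t) ^ α ≤ (|X ω| / s) ^ α := by
          have : 0 < t := hs.trans hst
          gcongr
        have h3 : 0 ≤ orliczPsi α (|X ω| / s) :=
          sub_nonneg.2 (Real.one_le_exp (Real.rpow_nonneg (by positivity) α))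
        rw [← ENNReal.ofReal_one, ← ENNReal.ofReal_add h3 zero_le_one]
        apply ENNReal.ofReal_le_ofReal
        simpa [orliczPsi] using h2
    _ ≤ 1 + 1 := by
        rw [lintegral_add_right _ measurable_const]
        gcongr
        simp
    _ = 2 := by norm_num

/-- The infimum defining the Orlicz norm is attained when it is positive. -/
lemma lintegral_exp_rpow_le_two {α : ℝ} (hα : 1 ≤ α) {X : Ω → ℝ} (hX : Measurable X)
    (hfin : orliczENorm μ α X ≠ ∞) (hk : 0 < orliczNorm μ α X) :
    ∫⁻ ω, ENNReal.ofReal (Real.exp ((|X ω| / orliczNorm μ α X) ^ α)) ∂μ ≤ 2 := by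
  set k := orliczNorm μ α X with hkdef
  set F : ℕ → Ω → ℝ≥0∞ :=
    fun m ω => ENNReal.ofReal (Real.exp ((|X ω| / (k + 1 / ((m : ℝ) + 1))) ^ α)) with hF
  have hFm : ∀ m, Measurable (F m) := fun m => by simp only [hF]; fun_prop
  have hF2 : ∀ m, ∫⁻ ω, F m ω ∂μ ≤ 2 := fun m =>
    lintegral_exp_rpow_le_two_of_orliczNorm_lt hα hfin (by
      have : 0 < 1 / ((m : ℝ) + 1) := by positivity
      linarith)
  have hlim : ∀ ω, Filter.Tendsto (fun m => F m ω) Filter.atTop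
      (nhds (ENNReal.ofReal (Real.exp ((|X ω| / k) ^ α)))) := by
    intro ω
    refine ENNReal.tendsto_ofReal ((Real.continuous_exp.tendsto _).comp ?_)
    refine Filter.Tendsto.rpow_const ?_ (Or.inr (by linarith))
    refine tendsto_const_nhds.div ?_ hk.ne'
    simpa using tendsto_const_nhds.add (tendsto_one_div_add_atTop_nhds_zero_nat (𝕜 := ℝ))
  calc _ = ∫⁻ ω, Filter.liminf (fun m => F m ω) Filter.atTop ∂μ :=
        lintegral_congr fun ω => (hlim ω).liminf_eq.symm
    _ ≤ Filter.liminf (fun m => ∫⁻ ω, F m ω ∂μ) Filter.atTop := lintegral_liminf_le hFm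
    _ ≤ Filter.liminf (fun _ : ℕ => (2 : ℝ≥0∞)) Filter.atTop :=
        Filter.liminf_le_liminf (.of_forall hF2)
    _ = 2 := by simp

lemma integrable_exp_rpow {α : ℝ} (hα : 1 ≤ α) {X : Ω → ℝ} (hX : Measurable X)
    (hfin : orliczENorm μ α X ≠ ∞) (hk : 0 < orliczNorm μ α X) :
    Integrable (fun ω => Real.exp ((|X ω| / orliczNorm μ α X) ^ α)) μ := by
  refine (lintegral_ofReal_ne_top_iff_integrable
    (by fun_prop : Measurable _).aestronglyMeasurable
    (.of_forall fun ω => (Real.exp_pos _).le)).1 ?_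
  exact ((lintegral_exp_rpow_le_two hα hX hfin hk).trans_lt (by simp)).ne

lemma integral_exp_rpow_le_two {α : ℝ} (hα : 1 ≤ α) {X : Ω → ℝ} (hX : Measurable X)
    (hfin : orliczENorm μ α X ≠ ∞) (hk : 0 < orliczNorm μ α X) :
    ∫ ω, Real.exp ((|X ω| / orliczNorm μ α X) ^ α) ∂μ ≤ 2 := by
  rw [integral_eq_lintegral_of_nonneg_ae (.of_forall fun ω => (Real.exp_pos _).le)
    (by fun_prop : Measurable _).aestronglyMeasurable]
  exact ENNReal.toReal_mono (by simp) (lintegral_exp_rpow_le_two hα hX hfin hk)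

lemma ae_eq_zero_of_orliczNorm_eq_zero {α : ℝ} (hα : 1 ≤ α) {X : Ω → ℝ} (hX : Measurable X)
    (hfin : orliczENorm μ α X ≠ ∞) (hk : orliczNorm μ α X = 0) : X =ᵐ[μ] 0 := by
  have h1 : ∀ t : ℝ, 0 < t → ∫⁻ ω, ENNReal.ofReal |X ω| ∂μ ≤ ENNReal.ofReal (t * 2) := by
    intro t ht
    calc ∫⁻ ω, ENNReal.ofReal |X ω| ∂μ
        ≤ ∫⁻ ω, ENNReal.ofReal t * ENNReal.ofReal (Real.exp ((|X ω| / t) ^ α)) ∂μ := by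
          refine lintegral_mono fun ω => ?_
          rw [← ENNReal.ofReal_mul ht.le]
          apply ENNReal.ofReal_le_ofReal
          rw [← div_le_iff₀' ht]
          exact self_le_exp_rpow hα (by positivity)
      _ = ENNReal.ofReal t * ∫⁻ ω, ENNReal.ofReal (Real.exp ((|X ω| / t) ^ α)) ∂μ :=
          lintegral_const_mul _ (by fun_prop)
      _ ≤ ENNReal.ofReal t * 2 := by
          gcongr
          exact lintegral_exp_rpow_le_two_of_orliczNorm_lt hα hfin (hk ▸ ht)
      _ = _ := by rw [ENNReal.ofReal_mul ht.le]; simp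
  have h0 : ∫⁻ ω, ENNReal.ofReal |X ω| ∂μ = 0 := by
    refine le_antisymm (ENNReal.le_of_forall_pos_le_add fun ε hε _ => ?_) bot_le
    have := h1 (ε / 2) (by positivity)
    simpa using this
  rw [lintegral_eq_zero_iff (by fun_prop)] at h0
  filter_upwards [h0] with ω hω
  simpa using hω

end

/-! ### One variable with finite Orlicz norm -/

/-- The left-hand side divided by `e ^ (g / 2)` is maximal at `g = 6`. -/
lemma pow_three_le_two_mul_exp (g : ℝ) : g ^ 3 ≤ 2 * Real.exp 2 * Real.exp (g / 2) := by
  rcases le_total g 0 with h | h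
  · have : g ^ 3 ≤ 0 := by nlinarith [sq_nonneg g]
    exact this.trans (by positivity)
  have h1 := Real.add_one_le_exp (g / 6 - 1)
  have h2 : (g / 6) ^ 3 ≤ Real.exp (g / 6 - 1) ^ 3 := by gcongr; linarith
  have h3 : Real.exp (g / 6 - 1) ^ 3 * Real.exp 5 = Real.exp 2 * Real.exp (g / 2) := by
    rw [← Real.exp_nat_mul, ← Real.exp_add, ← Real.exp_add]; congr 1; push_cast; ring
  have h4 : (108 : ℝ) ≤ Real.exp 5 := by
    have h5 : Real.exp 5 = Real.exp 1 ^ 5 := by rw [← Real.exp_nat_mul]; norm_num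
    rw [h5]
    calc (108 : ℝ) ≤ 2.7182818283 ^ 5 := by norm_num
      _ ≤ _ := by gcongr; exact Real.exp_one_gt_d9.le
  have h6 := mul_le_mul_of_nonneg_left h4 (pow_nonneg (Real.exp_pos (g / 6 - 1)).le 3)
  nlinarith

/-- Tangent line inequality for `s ↦ s ^ α` at `z`. -/
lemma rpow_tangent_le {α z w : ℝ} (hα : 1 ≤ α) (hz : 0 < z) (hw : 0 ≤ w) :
    z ^ α + α * z ^ α * (w / z - 1) ≤ w ^ α := by
  have h1 := one_add_mul_self_le_rpow_one_add (s := w / z - 1)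
    (by have : 0 ≤ w / z := by positivity
        linarith) hα
  rw [add_sub_cancel, Real.div_rpow hw hz.le, le_div_iff₀ (by positivity)] at h1
  linarith

/-- While `u` stays below half of `α * z ^ α`, the linear function with slope `u / z` grows beyond
`z` at most as fast as `w ↦ w ^ α / 2`. In the application `w` is `W / k`. -/
lemma linear_le_half_rpow {α z w u : ℝ} (hα : 1 ≤ α) (hz : 0 < z) (hzw : z ≤ w)
    (huz : u ≤ α * z ^ α / 2) : w / z * u - u ≤ w ^ α / 2 - z ^ α / 2 := by
  have h1 := rpow_tangent_le hα hz (hz.le.trans hzw)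
  have h2 : 0 ≤ w / z - 1 := sub_nonneg.2 ((one_le_div hz).2 hzw)
  nlinarith [mul_le_mul_of_nonneg_right huz h2]

/-- The pointwise bound for the higher-order part of the exponential.  Below the level `K * z`
it is governed by `W ^ 2`, above that level by the Orlicz exponential; the choice of `z` makes the
latter contribution small, which is the role of `hC`. -/
lemma expRem3_pointwise {α z K k W u C : ℝ} (hα : 1 ≤ α) (hz4 : 4 ≤ z ^ α) (hz1 : 1 ≤ z)
    (hk : 0 < k) (hkK : k ≤ K) (hW : 0 ≤ W) (hu : 0 ≤ u) (huz : u ≤ α * z ^ α / 2)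
    (hC : Real.exp (-(z ^ α / 2)) ≤ 2 * C / Real.exp 2) (hC0 : 0 ≤ C) :
    expRem3 (u / (K * z) * W) ≤
      expRem3 u / (K * z) ^ 2 * (W ^ 2 + C * k ^ 2 * Real.exp ((W / k) ^ α)) := by
  have hK : 0 < K := hk.trans_le hkK
  have hz : 0 < z := by linarith
  have hr := expRem3_nonneg hu
  set s := W / (K * z) with hs
  have hs0 : 0 ≤ s := by positivity
  have harg : u / (K * z) * W = s * u := by rw [hs]; ring
  have hWs : W = s * (K * z) := by rw [hs]; field_simp
  rw [harg]
  rcases le_total s 1 with h | h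
  · calc expRem3 (s * u) ≤ s ^ 2 * expRem3 u := expRem3_mul_le hs0 h hu
      _ = expRem3 u / (K * z) ^ 2 * W ^ 2 := by rw [hs]; field_simp
      _ ≤ _ := by
        gcongr
        have : 0 ≤ C * k ^ 2 * Real.exp ((W / k) ^ α) := by positivity
        linarith
  · set w := W / k with hw
    have hzw : z ≤ w := by
      rw [hw, le_div_iff₀ hk]
      have h1 : K * z ≤ W := by
        rw [hs, one_le_div (by positivity)] at h; exact h
      nlinarith
    have hw1 : 1 ≤ w := hz1.trans hzw
    have hWk : W = w * k := by rw [hw]; field_simp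
    have hsw : s ≤ w / z := by
      rw [hs, hw, div_div]
      gcongr
    set g := w ^ α with hg
    have hwg : w ≤ g := Real.self_le_rpow_of_one_le hw1 hα
    have hexp : Real.exp (s * u - u) ≤ Real.exp (g / 2) * (2 * C / Real.exp 2) := by
      calc Real.exp (s * u - u) ≤ Real.exp (g / 2 + -(z ^ α / 2)) := by
            apply Real.exp_le_exp.2
            have h1 := linear_le_half_rpow hα hz hzw huz
            have h2 := mul_le_mul_of_nonneg_right hsw hu
            linarith
        _ = Real.exp (g / 2) * Real.exp (-(z ^ α / 2)) := Real.exp_add _ _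
        _ ≤ _ := by gcongr
    -- of the three powers of `W` one is compared with `K * z`, which gains a factor `z ^ α ≥ 4`
    have hs3 : s ^ 3 * (K * z) ^ 2 ≤ k ^ 2 * (g ^ 3 / 4) := by
      have h1 : w / z ≤ g / 4 := by
        calc w / z ≤ (w / z) ^ α :=
              Real.self_le_rpow_of_one_le ((one_le_div hz).2 hzw) hα
          _ = g / z ^ α := Real.div_rpow (by linarith) hz.le α
          _ ≤ g / 4 := by gcongr
      have h2 : s ^ 3 * (K * z) ^ 2 = s * W ^ 2 := by rw [hWs]; ring
      rw [h2, hWk]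
      calc s * (w * k) ^ 2 ≤ g / 4 * (g * k) ^ 2 := by gcongr; exact hsw.trans h1
        _ = _ := by ring
    have hg3 := pow_three_le_two_mul_exp g
    have hgg : Real.exp g = Real.exp (g / 2) * Real.exp (g / 2) := by
      rw [← Real.exp_add]; ring_nf
    have hfin : s ^ 3 * Real.exp (s * u - u) * (K * z) ^ 2 ≤ C * k ^ 2 * Real.exp g := by
      calc s ^ 3 * Real.exp (s * u - u) * (K * z) ^ 2
          = (s ^ 3 * (K * z) ^ 2) * Real.exp (s * u - u) := by ring
        _ ≤ (k ^ 2 * (g ^ 3 / 4)) * (Real.exp (g / 2) * (2 * C / Real.exp 2)) := by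
            gcongr
        _ ≤ (k ^ 2 * (2 * Real.exp 2 * Real.exp (g / 2) / 4)) *
              (Real.exp (g / 2) * (2 * C / Real.exp 2)) := by gcongr
        _ = C * k ^ 2 * Real.exp g := by rw [hgg]; field_simp; ring
    calc expRem3 (s * u) ≤ s ^ 3 * Real.exp (s * u - u) * expRem3 u :=
          expRem3_mul_le_of_one_le h hu
      _ = expRem3 u / (K * z) ^ 2 * (s ^ 3 * Real.exp (s * u - u) * (K * z) ^ 2) := by
          field_simp
      _ ≤ _ := by
          gcongr
          nlinarith [sq_nonneg W]

lemma integrable_sq_of_exp {Ω : Type*} [MeasurableSpace Ω] {μ : Measure Ω} {c : ℝ} (hc : 0 < c)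
    {W : Ω → ℝ} (hW : Measurable W) (hW0 : ∀ ω, 0 ≤ W ω)
    (hint : Integrable (fun ω => Real.exp (c * W ω)) μ) :
    Integrable (fun ω => W ω ^ 2) μ := by
  refine (hint.const_mul (2 / c ^ 2)).mono' (by fun_prop) (.of_forall fun ω => ?_)
  have h1 := Real.quadratic_le_exp_of_nonneg (mul_nonneg hc.le (hW0 ω))
  rw [Real.norm_of_nonneg (sq_nonneg _), div_mul_eq_mul_div, le_div_iff₀ (by positivity)]
  nlinarith [mul_nonneg hc.le (hW0 ω)]

section
variable {Ω : Type*} [MeasurableSpace Ω] {μ : Measure Ω} [IsProbabilityMeasure μ]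

lemma integrable_exp_mul_of_orliczNorm {α z K u : ℝ} (hα : 1 ≤ α) (hz : 0 < z) (hK : 0 < K)
    {W : Ω → ℝ} (hW : Measurable W) (hW0 : ∀ ω, 0 ≤ W ω) (hfin : orliczENorm μ α W ≠ ∞)
    (hkK : orliczNorm μ α W ≤ K) (hu : 0 ≤ u) (huz : u ≤ α * z ^ α / 2) :
    Integrable (fun ω => Real.exp (u / (K * z) * W ω)) μ := by
  rcases (orliczNorm_nonneg μ α W).eq_or_lt with hk | hk
  · refine (integrable_const (1 : ℝ)).congr ?_
    filter_upwards [ae_eq_zero_of_orliczNorm_eq_zero hα hW hfin hk.symm] with ω hω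
    simp [hω]
  · refine ((integrable_exp_rpow hα hW hfin hk).const_mul (Real.exp u)).mono' (by fun_prop)
      (.of_forall fun ω => ?_)
    rw [Real.norm_of_nonneg (Real.exp_pos _).le, ← Real.exp_add, abs_of_nonneg (hW0 ω)]
    apply Real.exp_le_exp.2
    set w := W ω / orliczNorm μ α W with hw
    have hw0 : 0 ≤ w := div_nonneg (hW0 ω) hk.le
    have hg0 : 0 ≤ w ^ α := Real.rpow_nonneg hw0 α
    have h1 : u / (K * z) * W ω ≤ w / z * u := by
      calc u / (K * z) * W ω = W ω / K / z * u := by field_simp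
        _ ≤ w / z * u := by
          have := hW0 ω
          rw [hw]; gcongr
    rcases le_total z w with h | h
    · have h2 := linear_le_half_rpow hα hz h huz
      have h3 : 0 ≤ z ^ α := Real.rpow_nonneg hz.le α
      linarith
    · have h2 : w / z * u ≤ 1 * u := by gcongr; exact (div_le_one hz).2 h
      linarith

/-- With `C = σ ^ 2 / (2 * U ^ 2)` the last summands `2 * C * k ^ 2` add up to `σ ^ 2` over all the
variables. -/
lemma integral_expRem2_le {α z K u C : ℝ} (hα : 1 ≤ α) (hz4 : 4 ≤ z ^ α) (hz1 : 1 ≤ z)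
    (hK : 0 < K) {W : Ω → ℝ} (hW : Measurable W) (hW0 : ∀ ω, 0 ≤ W ω)
    (hfin : orliczENorm μ α W ≠ ∞) (hkK : orliczNorm μ α W ≤ K)
    (hu : 0 < u) (huz : u ≤ α * z ^ α / 2)
    (hC : Real.exp (-(z ^ α / 2)) ≤ 2 * C / Real.exp 2) (hC0 : 0 ≤ C) :
    ∫ ω, expRem2 (u / (K * z) * W ω) ∂μ ≤
      (u / (K * z)) ^ 2 / 2 * ∫ ω, W ω ^ 2 ∂μ + expRem3 u / (K * z) ^ 2 *
        (∫ ω, W ω ^ 2 ∂μ + 2 * C * orliczNorm μ α W ^ 2) := by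
  have hz : 0 < z := by linarith
  rcases (orliczNorm_nonneg μ α W).eq_or_lt with hk | hk
  · have h0 := ae_eq_zero_of_orliczNorm_eq_zero hα hW hfin hk.symm
    have h1 : ∫ ω, expRem2 (u / (K * z) * W ω) ∂μ = 0 := by
      refine integral_eq_zero_of_ae ?_
      filter_upwards [h0] with ω hω
      simp [hω, expRem2]
    have h2 : ∫ ω, W ω ^ 2 ∂μ = 0 := by
      refine integral_eq_zero_of_ae ?_
      filter_upwards [h0] with ω hω
      simp [hω]
    rw [h1, h2, ← hk]; simp
  · have hei := integrable_exp_mul_of_orliczNorm hα hz hK hW hW0 hfin hkK hu.le huz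
    have hsq := integrable_sq_of_exp (by positivity) hW hW0 hei
    have hXi := integrable_exp_rpow hα hW hfin hk
    have hX2 := integral_exp_rpow_le_two hα hW hfin hk
    simp_rw [fun ω => abs_of_nonneg (hW0 ω)] at hXi hX2
    set k := orliczNorm μ α W
    set c := u / (K * z)
    have hA : Integrable (fun ω => c ^ 2 / 2 * W ω ^ 2) μ := hsq.const_mul _
    have hB : Integrable (fun ω => W ω ^ 2 + C * k ^ 2 * Real.exp ((W ω / k) ^ α)) μ :=
      hsq.add (hXi.const_mul _)
    have hr : 0 ≤ expRem3 u / (K * z) ^ 2 := div_nonneg (expRem3_nonneg hu.le) (sq_nonneg _)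
    calc ∫ ω, expRem2 (c * W ω) ∂μ
        ≤ ∫ ω, (c ^ 2 / 2 * W ω ^ 2 + expRem3 u / (K * z) ^ 2 *
            (W ω ^ 2 + C * k ^ 2 * Real.exp ((W ω / k) ^ α))) ∂μ := by
          refine integral_mono_of_nonneg (.of_forall fun ω => expRem2_nonneg _)
            (hA.add (hB.const_mul _)) (.of_forall fun ω => ?_)
          have := expRem3_pointwise hα hz4 hz1 hk hkK (hW0 ω) hu.le huz hC hC0
          simp only
          rw [expRem2_eq, mul_pow, mul_div_right_comm]
          linarith
      _ = c ^ 2 / 2 * ∫ ω, W ω ^ 2 ∂μ + expRem3 u / (K * z) ^ 2 *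
            (∫ ω, W ω ^ 2 ∂μ + C * k ^ 2 * ∫ ω, Real.exp ((W ω / k) ^ α) ∂μ) := by
          rw [integral_add hA (hB.const_mul _), integral_const_mul, integral_const_mul,
            integral_add hsq (hXi.const_mul _), integral_const_mul]
      _ ≤ _ := by
          have h1 : C * k ^ 2 * ∫ ω, Real.exp ((W ω / k) ^ α) ∂μ ≤ C * k ^ 2 * 2 := by gcongr
          have h2 : C * k ^ 2 * ∫ ω, Real.exp ((W ω / k) ^ α) ∂μ ≤ 2 * C * k ^ 2 := by linarith
          gcongr

end

/-! ### Deviation of the norm of a sum -/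

lemma sub_abs_halfNormSum_le {E : Type*} [NormedAddCommGroup E] {n : ℕ} (a b : Fin n → E) :
    |halfNormSum a - halfNormSum b| ≤ 1 / 2 * ∑ i, ‖a i - b i‖ := by
  simp only [halfNormSum]
  rw [← mul_sub, abs_mul, abs_of_pos (by norm_num : (0 : ℝ) < 1 / 2)]
  gcongr
  refine (abs_norm_sub_norm_le _ _).trans ?_
  rw [← Finset.sum_sub_distrib]
  exact norm_sum_le _ _

/-- The norm is measurable because it is, up to a factor, a section of `halfNormSum`; no
compatibility between the topology and the `σ`-algebra of the space is needed. -/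
lemma measurable_norm_of_halfNormSum {E : Type*} [NormedAddCommGroup E] [MeasurableSpace E]
    {n : ℕ} (hn : 0 < n) (hf : Measurable (halfNormSum : (Fin n → E) → ℝ)) :
    Measurable (fun y : E => ‖y‖) := by
  classical
  let j : Fin n := ⟨0, hn⟩
  have h : Measurable fun y : E => 2 * halfNormSum (Function.update (0 : Fin n → E) j y) :=
    (hf.comp (measurable_update _)).const_mul 2
  convert h using 2 with y
  have : ∑ i, Function.update (0 : Fin n → E) j y i = y := by
    rw [Finset.sum_update_of_mem (Finset.mem_univ j)]; simp
  simp [halfNormSum, this]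

/-- Chernoff's bound in terms of a Lebesgue integral. -/
lemma measureReal_lt_le_of_lintegral_exp {Ω : Type*} [MeasurableSpace Ω] {μ : Measure Ω}
    [IsProbabilityMeasure μ] {Z : Ω → ℝ} (hZ : Measurable Z) {c b x ψ : ℝ} (hc : 0 ≤ c)
    (h : ∫⁻ ω, ENNReal.ofReal (Real.exp (c * Z ω)) ∂μ ≤ ENNReal.ofReal (Real.exp ψ))
    (hx : x + ψ ≤ c * b) : μ.real {ω | b < Z ω} ≤ Real.exp (-x) := by
  have h1 := mul_meas_ge_le_lintegral₀ (μ := μ)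
    (f := fun ω => ENNReal.ofReal (Real.exp (c * Z ω))) (by fun_prop)
    (ENNReal.ofReal (Real.exp (c * b)))
  have h2 : μ {ω | b < Z ω} ≤
      μ {ω | ENNReal.ofReal (Real.exp (c * b)) ≤ ENNReal.ofReal (Real.exp (c * Z ω))} := by
    refine measure_mono fun ω hω => ?_
    have hω : b < Z ω := hω
    exact ENNReal.ofReal_le_ofReal (Real.exp_le_exp.2 (by gcongr))
  have h3 : ENNReal.ofReal (Real.exp (c * b)) * μ {ω | b < Z ω} ≤
      ENNReal.ofReal (Real.exp ψ) :=
    (mul_le_mul_right h2 _).trans (h1.trans h)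
  have h4 := ENNReal.toReal_mono (by simp) h3
  rw [ENNReal.toReal_mul, ENNReal.toReal_ofReal (Real.exp_pos _).le,
    ENNReal.toReal_ofReal (Real.exp_pos _).le] at h4
  have h5 : Real.exp ψ ≤ Real.exp (c * b) * Real.exp (-x) := by
    rw [← Real.exp_add]; exact Real.exp_le_exp.2 (by linarith)
  exact le_of_mul_le_mul_left (h4.trans h5) (Real.exp_pos _)

lemma one_le_truncLog (x : ℝ) : 1 ≤ truncLog x := le_max_right _ _

/-- The Bennett-type bound admits a Chernoff parameter: when the truncated logarithm exceeds one
this is `bennett_exponent`, and otherwise the Bernstein exponent is good enough. -/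
lemma exists_exponent_bennettBound {n : ℕ} (hn : 0 < n) {α σ K z x : ℝ} (hα : 1 ≤ α)
    (hσ : 0 < σ) (hK : 0 < K) (hz : 0 < z) (hz4 : 4 ≤ z ^ α) (hx : 0 < x) :
    ∃ u, 0 < u ∧ u ≤ α * z ^ α / 2 ∧
      x + σ ^ 2 / (K * z) ^ 2 * (u ^ 2 / 2 + 2 * expRem3 u) ≤
        u / (K * z) * bennettBound n α σ K z x := by
  have hr1 : 1 ≤ ((n : ℝ) + 1) / n := by
    rw [one_le_div (by positivity)]; linarith
  set r := ((n : ℝ) + 1) / n with hr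
  have hr0 : 0 < r := by linarith
  have hB : 0 < K * z := by positivity
  have hαz : 4 ≤ α * z ^ α := by nlinarith
  have hsq : √(2 * x) ≤ √(2 * x * r) := Real.sqrt_le_sqrt (by nlinarith)
  set M := min (2 * α * z ^ α) (truncLog ((K * z / (σ * r)) ^ 2 * x)) with hM
  have hM1 : 1 ≤ M := le_min (by linarith) (one_le_truncLog _)
  have hb : bennettBound n α σ K z x = σ * √(2 * x * r) + 4 * K * z * x / M := rfl
  rcases le_total 1 (Real.log ((K * z / (σ * r)) ^ 2 * x)) with h | h
  · refine ⟨M / 4, by positivity, ?_, ?_⟩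
    · have : M ≤ 2 * α * z ^ α := min_le_left _ _
      linarith
    · have hML : M ≤ Real.log ((K * z / σ) ^ 2 * x) := by
        refine (min_le_right _ _).trans ?_
        rw [truncLog, max_eq_left h]
        apply Real.log_le_log (by positivity)
        gcongr
        nlinarith
      refine (bennett_exponent hσ hB hx (by linarith) hML).trans ?_
      rw [hb, mul_assoc 4 K z]
      gcongr
  · obtain ⟨u, hu0, hu2, hu⟩ := exists_bernstein_exponent hσ hB hx
    refine ⟨u, hu0, by linarith, hu.trans ?_⟩
    have hMe : M = 1 := le_antisymm
      ((min_le_right _ _).trans (by rw [truncLog, max_eq_right h])) hM1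
    rw [hb, hMe]
    gcongr
    have : 0 < K * z * x := by positivity
    linarith

lemma exists_exponent_bernsteinBound {n : ℕ} (hn : 0 < n) {α σ K z x : ℝ} (hα : 1 ≤ α)
    (hσ : 0 < σ) (hK : 0 < K) (hz : 0 < z) (hz4 : 4 ≤ z ^ α) (hx : 0 < x) :
    ∃ u, 0 < u ∧ u ≤ α * z ^ α / 2 ∧
      x + σ ^ 2 / (K * z) ^ 2 * (u ^ 2 / 2 + 2 * expRem3 u) ≤
        u / (K * z) * bernsteinBound n σ K z x := by
  have hr1 : 1 ≤ ((n : ℝ) + 1) / n := by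
    rw [one_le_div (by positivity)]; linarith
  obtain ⟨u, hu0, hu2, hu⟩ := exists_bernstein_exponent hσ (by positivity : 0 < K * z) hx
  refine ⟨u, hu0, by nlinarith, hu.trans ?_⟩
  have h1 : √(2 * x) ≤ √(2 * x * (((n : ℝ) + 1) / n)) := Real.sqrt_le_sqrt (by nlinarith)
  have h2 : 3 / 4 * (K * z) * x ≤ 3 / 4 * K * z * x * (((n : ℝ) + 1) / n) := by
    have : 0 < 3 / 4 * K * z * x := by positivity
    nlinarith
  unfold bernsteinBound
  gcongr

lemma bennettBound_nonneg {n : ℕ} {α σ K z x : ℝ} (hα : 1 ≤ α) (hσ : 0 ≤ σ) (hK : 0 ≤ K)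
    (hz : 0 ≤ z) (hx : 0 ≤ x) : 0 ≤ bennettBound n α σ K z x := by
  have h1 : 0 ≤ min (2 * α * z ^ α) (truncLog ((K * z / (σ * (((n : ℝ) + 1) / n))) ^ 2 * x)) :=
    le_min (by positivity) (zero_le_one.trans (one_le_truncLog _))
  unfold bennettBound
  positivity

lemma bernsteinBound_nonneg {n : ℕ} {σ K z x : ℝ} (hσ : 0 ≤ σ) (hK : 0 ≤ K)
    (hz : 0 ≤ z) (hx : 0 ≤ x) : 0 ≤ bernsteinBound n σ K z x := by
  unfold bernsteinBound
  positivity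

section
variable {Ω : Type*} [MeasurableSpace Ω] {μ : Measure Ω} [IsProbabilityMeasure μ]
  {E : Type*} [NormedAddCommGroup E] [MeasurableSpace E]

/-- Moment generating function of a `1/2`-Lipschitz function of independent variables. -/
lemma lintegral_exp_lipschitz_indep_le {n : ℕ} (hE : Measurable (fun y : E => ‖y‖))
    {Y : Fin n → Ω → E} (hY : ∀ i, Measurable (Y i)) (hindep : iIndepFun Y μ) {c : ℝ} (hc : 0 < c)
    (hint : ∀ i, Integrable (fun ω => Real.exp (c * ‖Y i ω‖)) μ)
    {g : (Fin n → E) → ℝ} (hg : Measurable g)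
    (hl : ∀ a b, |g a - g b| ≤ 1 / 2 * ∑ i, ‖a i - b i‖) :
    ∫⁻ ω, ENNReal.ofReal (Real.exp (c * (g (fun i => Y i ω) -
        ∫ ω', g (fun i => Y i ω') ∂μ))) ∂μ ≤
      ENNReal.ofReal (Real.exp (∑ i, ∫ ω, expRem2 (c * ‖Y i ω‖) ∂μ)) := by
  have hYm : Measurable fun ω i => Y i ω := measurable_pi_lambda _ hY
  have hmap : μ.map (fun ω i => Y i ω) = Measure.pi fun i => μ.map (Y i) :=
    (iIndepFun_iff_map_fun_eq_pi_map fun i => (hY i).aemeasurable).1 hindep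
  have : ∀ i, IsProbabilityMeasure (μ.map (Y i)) := fun i =>
    Measure.isProbabilityMeasure_map (hY i).aemeasurable
  have hem : Measurable fun y : E => Real.exp (c * ‖y‖) := (hE.const_mul c).exp
  have key := lintegral_exp_lipschitz_pi_le hE hc (fun i => μ.map (Y i))
    (fun i => (integrable_map_measure hem.aestronglyMeasurable (hY i).aemeasurable).2 (hint i))
    hg hl
  rw [← hmap, integral_map hYm.aemeasurable hg.aestronglyMeasurable,
    lintegral_map ((hg.sub_const _).const_mul c).exp.ennreal_ofReal hYm] at key
  have hR : Measurable fun y : E => expRem2 (c * ‖y‖) := (hem.sub_const 1).sub (hE.const_mul c)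
  simpa only [integral_map (hY _).aemeasurable hR.aestronglyMeasurable] using key

lemma measureReal_halfNormSum_lt_le {n : ℕ} (hn : 0 < n)
    (hf : Measurable (halfNormSum : (Fin n → E) → ℝ))
    {Y : Fin n → Ω → E} (hY : ∀ i, Measurable (Y i)) (hindep : iIndepFun Y μ)
    {α : ℝ} (hα : 1 ≤ α) (hfin : ∀ i, orliczENorm μ α (fun ω => ‖Y i ω‖) ≠ ∞)
    {K U σ z : ℝ} (hK : K = ⨆ i, orliczNorm μ α (fun ω => ‖Y i ω‖))
    (hU : U = √(∑ i, orliczNorm μ α (fun ω => ‖Y i ω‖) ^ 2))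
    (hσ : σ = √(∑ i, ∫ ω, ‖Y i ω‖ ^ 2 ∂μ))
    (hz : z = (4 * truncLog (Real.exp 1 * U / σ)) ^ (1 / α))
    (hσ0 : 0 < σ) {x b : ℝ}
    (hb : 0 < K → 0 < z → 4 ≤ z ^ α → ∃ u, 0 < u ∧ u ≤ α * z ^ α / 2 ∧
      x + σ ^ 2 / (K * z) ^ 2 * (u ^ 2 / 2 + 2 * expRem3 u) ≤ u / (K * z) * b) :
    μ.real {ω | b < halfNormSum (fun i => Y i ω) - ∫ ω', halfNormSum (fun i => Y i ω') ∂μ} ≤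
      Real.exp (-x) := by
  have hE := measurable_norm_of_halfNormSum hn hf
  have hW : ∀ i, Measurable fun ω => ‖Y i ω‖ := fun i => hE.comp (hY i)
  have hW0 : ∀ i ω, 0 ≤ ‖Y i ω‖ := fun i ω => norm_nonneg _
  set k : Fin n → ℝ := fun i => orliczNorm μ α (fun ω => ‖Y i ω‖) with hkdef
  have hk0 : ∀ i, 0 ≤ k i := fun i => orliczNorm_nonneg _ _ _
  have hkK : ∀ i, k i ≤ K := fun i => hK ▸ le_ciSup (Set.finite_range k).bddAbove i
  have hσ2 : σ ^ 2 = ∑ i, ∫ ω, ‖Y i ω‖ ^ 2 ∂μ := by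
    rw [hσ, Real.sq_sqrt (Finset.sum_nonneg fun i _ => integral_nonneg fun ω => sq_nonneg _)]
  have hU2 : U ^ 2 = ∑ i, k i ^ 2 := by
    rw [hU, Real.sq_sqrt (Finset.sum_nonneg fun i _ => sq_nonneg _)]
  obtain ⟨i₀, hi₀⟩ : ∃ i, 0 < k i := by
    by_contra! h
    have h0 : ∑ i, ∫ ω, ‖Y i ω‖ ^ 2 ∂μ = 0 := Finset.sum_eq_zero fun i _ => by
      refine integral_eq_zero_of_ae ?_
      filter_upwards [ae_eq_zero_of_orliczNorm_eq_zero hα (hW i) (hfin i)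
        (le_antisymm (h i) (hk0 i))] with ω hω
      have hω : ‖Y i ω‖ = 0 := hω
      simp [hω]
    rw [h0] at hσ2
    nlinarith
  have hK0 : 0 < K := hi₀.trans_le (hkK i₀)
  have hU0 : 0 < U := by
    rw [hU]
    exact Real.sqrt_pos.2 (Finset.sum_pos' (fun i _ => sq_nonneg _)
      ⟨i₀, Finset.mem_univ _, pow_pos hi₀ 2⟩)
  have ht1 := one_le_truncLog (Real.exp 1 * U / σ)
  have hzα : z ^ α = 4 * truncLog (Real.exp 1 * U / σ) := by
    rw [hz, ← Real.rpow_mul (by linarith), one_div_mul_cancel (by linarith), Real.rpow_one]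
  have hz1 : 1 ≤ z := by
    rw [hz]; exact Real.one_le_rpow (by linarith) (by positivity)
  have hz0 : 0 < z := by linarith
  have hz4 : 4 ≤ z ^ α := by rw [hzα]; linarith
  -- the choice of `z` makes the weight of the region beyond the level `K * z` at most
  -- `(σ / (e * U)) ^ 2`
  have hC : Real.exp (-(z ^ α / 2)) ≤ 2 * (σ ^ 2 / (2 * U ^ 2)) / Real.exp 2 := by
    have h1 : Real.log (Real.exp 1 * U / σ) ≤ z ^ α / 4 := by
      rw [hzα]; have := le_max_left (Real.log (Real.exp 1 * U / σ)) 1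
      unfold truncLog; linarith
    have h2 : Real.exp 2 = Real.exp 1 ^ 2 := by rw [← Real.exp_nat_mul]; norm_num
    calc Real.exp (-(z ^ α / 2))
        ≤ Real.exp (-(2 * Real.log (Real.exp 1 * U / σ))) := Real.exp_le_exp.2 (by linarith)
      _ = (Real.exp (Real.log (Real.exp 1 * U / σ)) ^ 2)⁻¹ := by
          rw [← Real.exp_nat_mul, ← Real.exp_neg]; norm_num
      _ = 2 * (σ ^ 2 / (2 * U ^ 2)) / Real.exp 2 := by
          rw [Real.exp_log (by positivity), h2]; field_simp
  obtain ⟨u, hu0, huz, hu⟩ := hb hK0 hz0 hz4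
  have hB : 0 < K * z := by positivity
  have hsum : ∑ i, ∫ ω, expRem2 (u / (K * z) * ‖Y i ω‖) ∂μ ≤
      σ ^ 2 / (K * z) ^ 2 * (u ^ 2 / 2 + 2 * expRem3 u) := by
    calc _ ≤ ∑ i, ((u / (K * z)) ^ 2 / 2 * ∫ ω, ‖Y i ω‖ ^ 2 ∂μ + expRem3 u / (K * z) ^ 2 *
          (∫ ω, ‖Y i ω‖ ^ 2 ∂μ + 2 * (σ ^ 2 / (2 * U ^ 2)) * k i ^ 2)) :=
          Finset.sum_le_sum fun i _ => integral_expRem2_le hα hz4 hz1 hK0 (hW i) (hW0 i)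
            (hfin i) (hkK i) hu0 huz hC (by positivity)
      _ = _ := by
          rw [Finset.sum_add_distrib, ← Finset.mul_sum, ← Finset.mul_sum,
            Finset.sum_add_distrib, ← Finset.mul_sum, ← hσ2, ← hU2]
          field_simp
          ring
  have hYm : Measurable fun ω i => Y i ω := measurable_pi_lambda _ hY
  exact measureReal_lt_le_of_lintegral_exp ((hf.comp hYm).sub_const _) (by positivity)
    (lintegral_exp_lipschitz_indep_le hE hY hindep (by positivity)
      (fun i => integrable_exp_mul_of_orliczNorm hα hz0 hK0 (hW i) (hW0 i) (hfin i) (hkK i)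
        hu0.le huz) hf sub_abs_halfNormSum_le)
    (le_trans (by linarith) hu)

end

theorem mainTheorem6
    {Ω : Type*} [MeasurableSpace Ω] (μ : Measure Ω) [IsProbabilityMeasure μ]
    {E : Type*} [NormedAddCommGroup E] [NormedSpace ℝ E] [MeasurableSpace E]
    (n : ℕ) (hn : 0 < n)
    (hf : Measurable (halfNormSum : (Fin n → E) → ℝ))
    (Y : Fin n → Ω → E) (hY : ∀ i, Measurable (Y i)) (hindep : iIndepFun Y μ)
    (α : ℝ) (hα : 1 ≤ α)
    (hfin : ∀ i, orliczENorm μ α (fun ω => ‖Y i ω‖) ≠ ∞)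
    (K U σ z : ℝ)
    (hK : K = ⨆ i, orliczNorm μ α (fun ω => ‖Y i ω‖))
    (hU : U = √(∑ i, orliczNorm μ α (fun ω => ‖Y i ω‖) ^ 2))
    (hσ : σ = √(∑ i, ∫ ω, ‖Y i ω‖ ^ 2 ∂μ))
    (hz : z = (4 * truncLog (Real.exp 1 * U / σ)) ^ (1 / α))
    (x : ℝ) (hx : 0 < x) :
    1 - Real.exp (-x) ≤
      μ.real {ω |
        halfNormSum (fun i => Y i ω) - ∫ ω', halfNormSum (fun i => Y i ω') ∂μ
            ≤ bennettBound n α σ K z x ∧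
        halfNormSum (fun i => Y i ω) - ∫ ω', halfNormSum (fun i => Y i ω') ∂μ
            ≤ bernsteinBound n σ K z x} := by
  have hE := measurable_norm_of_halfNormSum hn hf
  have hYm : Measurable fun ω i => Y i ω := measurable_pi_lambda _ hY
  set Z : Ω → ℝ := fun ω =>
    halfNormSum (fun i => Y i ω) - ∫ ω', halfNormSum (fun i => Y i ω') ∂μ with hZ
  have hZm : Measurable Z := (hf.comp hYm).sub_const _
  -- both bounds are deterministic, so the event only involves the smaller one
  suffices h : μ.real {ω | min (bennettBound n α σ K z x) (bernsteinBound n σ K z x) < Z ω} ≤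
      Real.exp (-x) by
    have h1 := probReal_compl_eq_one_sub (μ := μ) (measurableSet_lt measurable_const hZm :
      MeasurableSet {ω | min (bennettBound n α σ K z x) (bernsteinBound n σ K z x) < Z ω})
    have h2 : {ω | Z ω ≤ bennettBound n α σ K z x ∧ Z ω ≤ bernsteinBound n σ K z x} =
        {ω | min (bennettBound n α σ K z x) (bernsteinBound n σ K z x) < Z ω}ᶜ := by
      ext ω
      simp only [Set.mem_compl_iff, Set.mem_ofPred_eq, not_lt, le_min_iff]
    change 1 - Real.exp (-x) ≤
      μ.real {ω | Z ω ≤ bennettBound n α σ K z x ∧ Z ω ≤ bernsteinBound n σ K z x}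
    rw [h2, h1]
    linarith
  have hσn : 0 ≤ σ := hσ ▸ Real.sqrt_nonneg _
  rcases hσn.eq_or_lt with hσ0 | hσ0
  · -- all variables vanish almost surely
    have hα0 : 0 < α := by linarith
    have hKn : 0 ≤ K := hK ▸ Real.iSup_nonneg fun i => orliczNorm_nonneg _ _ _
    have hzn : 0 ≤ z := by
      have := one_le_truncLog (Real.exp 1 * U / σ)
      rw [hz]; positivity
    have hint0 : ∀ i, ∫ ω, ‖Y i ω‖ ^ 2 ∂μ = 0 := by
      have hnn : ∀ i ∈ Finset.univ, 0 ≤ ∫ ω, ‖Y i ω‖ ^ 2 ∂μ := fun i _ =>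
        integral_nonneg fun ω => sq_nonneg _
      have h0 := hσ0 ▸ hσ
      have h1 := (Real.sqrt_eq_zero (Finset.sum_nonneg hnn)).1 h0.symm
      exact fun i => (Finset.sum_eq_zero_iff_of_nonneg hnn).1 h1 i (Finset.mem_univ i)
    have hY0 : ∀ i, ∀ᵐ ω ∂μ, Y i ω = 0 := by
      intro i
      have hWm : Measurable fun ω => ‖Y i ω‖ := hE.comp (hY i)
      have hK1 : 0 < K + 1 := by linarith
      have hkK : orliczNorm μ α (fun ω => ‖Y i ω‖) ≤ K + 1 := by
        have := le_ciSup (Set.finite_range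
          fun i => orliczNorm μ α (fun ω => ‖Y i ω‖)).bddAbove i
        rw [← hK] at this
        linarith
      have he := integrable_exp_mul_of_orliczNorm (z := 1) (u := 1 / 2) hα one_pos hK1 hWm
        (fun ω => norm_nonneg _) (hfin i) hkK (by norm_num) (by simp; linarith)
      have hsq := integrable_sq_of_exp (by positivity) hWm (fun ω => norm_nonneg _) he
      filter_upwards [(integral_eq_zero_iff_of_nonneg (fun ω => sq_nonneg _) hsq).1 (hint0 i)]
        with ω hω
      simpa using hω
    have hf0 : ∀ᵐ ω ∂μ, halfNormSum (fun i => Y i ω) = 0 := by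
      filter_upwards [ae_all_iff.2 hY0] with ω hω
      simp [halfNormSum, hω]
    have hm : ∫ ω', halfNormSum (fun i => Y i ω') ∂μ = 0 := integral_eq_zero_of_ae hf0
    have hb : 0 ≤ min (bennettBound n α σ K z x) (bernsteinBound n σ K z x) :=
      le_min (bennettBound_nonneg hα hσn hKn hzn hx.le) (bernsteinBound_nonneg hσn hKn hzn hx.le)
    have hnull : μ {ω | min (bennettBound n α σ K z x) (bernsteinBound n σ K z x) < Z ω} = 0 := by
      refine measure_mono_null ?_ (ae_iff.1 hf0)
      intro ω hω h0
      have hω : min (bennettBound n α σ K z x) (bernsteinBound n σ K z x) < Z ω := hω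
      have hZ0 : Z ω = 0 := by simp only [hZ, hm, h0, sub_zero]
      linarith
    rw [measureReal_def, hnull]
    simpa using (Real.exp_pos (-x)).le
  · rcases min_choice (bennettBound n α σ K z x) (bernsteinBound n σ K z x) with h | h <;> rw [h]
    · exact measureReal_halfNormSum_lt_le hn hf hY hindep hα hfin hK hU hσ hz hσ0
        fun hK0 hz0 hz4 => exists_exponent_bennettBound hn hα hσ0 hK0 hz0 hz4 hx
    · exact measureReal_halfNormSum_lt_le hn hf hY hindep hα hfin hK hU hσ hz hσ0
        fun hK0 hz0 hz4 => exists_exponent_bernsteinBound hn hα hσ0 hK0 hz0 hz4 hx
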